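/- For words $x$ and $y$ with $x$ nonempty and $y$ a prefix of $x$, and an integer $k \ge 0$ such that $R = k + |y|/|x| > 1$, the word $u = x^k y$ is called an $R$-power of period $|x|$. For a rational number $N > 1$, an $N^+$-power of period $m$ is a word that is an $R$-power of period $m$ for some rational $R > N$. A finite word $w$ avoids $N^+$-powers cyclically if every $N^+$-power occurring as a factor in the infinite word $w^\omega = www\cdots$ has period $m \ge |w|$ (this holds vacuously for the empty word). Let $\mathbf{t} = \sigma^\omega(0)$ be the Thue–Morse word, the infinite word that has $\sigma^n(0)$ as a prefix for all $n \ge 0$, where $\sigma$ is the morphism $0 \mapsto 01$, $1 \mapsto 10$. Theorem. For every integer $n \ge 0$ there exists a factor of length $n$ of the Thue–Morse word $\mathbf{t}$ that avoids $5/2^+$-powers cyclically (where $5/2^+$ means $N^+$ with $N = 5/2$). Consequently, for every integer $n \ge 0$ there exists a word of length $n$ over the $2$-letter alphabet $\{0,1\}$ that avoids $5/2^+$-powers cyclically. -/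

import Mathlib

/-- An infinite word over `α`, indexed from `0`. -/
abbrev InfWord (α : Type*) := ℕ → α

/-- The finite word `u` is a factor of (occurs in) the infinite word `x`. -/
def InfWord.HasFactor {α : Type*} (x : InfWord α) (u : List α) : Prop :=
  ∃ i : ℕ, u = (List.range u.length).map fun j => x (i + j)

/-- The infinite repetition `w^ω = w w w ⋯` of a nonempty finite word `w`. -/
def omegaPower {α : Type*} (w : List α) (hw : w ≠ []) : InfWord α :=
  fun i => w[i % w.length]'(Nat.mod_lt i (List.length_pos_iff.mpr hw))

/-- `u` is a (fractional) `R`-power of period `m`, where `R > 1`: there are a nonempty word `x` of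
length `m`, a prefix `y` of `x` and a natural number `k` with `u = x^k y` and
`R = k + |y| / |x|`. -/
def IsPowerWithPeriod {α : Type*} (R : ℚ) (m : ℕ) (u : List α) : Prop :=
  1 < R ∧ ∃ (x y : List α) (k : ℕ), x ≠ [] ∧ x.length = m ∧ y <+: x ∧
    u = (List.replicate k x).flatten ++ y ∧ R = (k : ℚ) + (y.length : ℚ) / (x.length : ℚ)

/-- `u` is an `N⁺`-power of period `m`: an `R`-power of period `m` for some rational `R > N`. -/
def IsPlusPowerWithPeriod {α : Type*} (N : ℚ) (m : ℕ) (u : List α) : Prop :=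
  ∃ R : ℚ, N < R ∧ IsPowerWithPeriod R m u

/-- The word `w` avoids `N⁺`-powers cyclically: each `N⁺`-power occurring in `w^ω` has
period at least `|w|`. (For the empty word there is nothing to check, since every period is at
least `0`.) -/
def AvoidsPlusPowersCyclically {α : Type*} (N : ℚ) (w : List α) : Prop :=
  ∀ hw : w ≠ [], ∀ (u : List α) (m : ℕ),
    IsPlusPowerWithPeriod N m u → (omegaPower w hw).HasFactor u → w.length ≤ m

/-- The images of the letters under the Thue–Morse morphism `0 ↦ 01`, `1 ↦ 10`. -/
def thueMorseLetter : Fin 2 → List (Fin 2)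
  | 0 => [0, 1]
  | 1 => [1, 0]

/-- The Thue–Morse morphism on finite binary words. -/
def thueMorseMorphism (w : List (Fin 2)) : List (Fin 2) :=
  w.flatMap thueMorseLetter

theorem length_thueMorseMorphism (w : List (Fin 2)) :
    (thueMorseMorphism w).length = 2 * w.length := by
  induction w with
  | nil => rfl
  | cons a w ih =>
    have ha : (thueMorseLetter a).length = 2 := by fin_cases a <;> rfl
    simp only [thueMorseMorphism, List.flatMap_cons, List.length_append, List.length_cons] at ih ⊢
    omega

theorem length_iterate_thueMorseMorphism (n : ℕ) :
    (thueMorseMorphism^[n] [0]).length = 2 ^ n := by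
  induction n with
  | zero => rfl
  | succ n ih =>
    rw [Function.iterate_succ_apply', length_thueMorseMorphism, ih, pow_succ, mul_comm]

/-- The Thue–Morse word `σ^ω(0)`, the limit of the words `σ^n(0)`, where `σ` is the Thue–Morse
morphism. As each `σ^n(0)` is a prefix of the next one and has length `2^n > n`, the letter of the
limit at position `n` is the one of `σ^n(0)`. -/
def thueMorse : InfWord (Fin 2) :=
  fun n => (thueMorseMorphism^[n] [0])[n]'(by
    rw [length_iterate_thueMorseMorphism]; exact Nat.lt_two_pow_self)

/-!
A factor of length `n` of the Thue–Morse word `t` is given by its position `i`, and the periodic word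
`z p = t (i + p % n)` is its infinite repetition. A `5/2⁺`-power of period `m` at position `j` of `z`
says that `z (j + k) = z (j + k + m)` for all `k ≤ 3m/2`, so these coincidences have to be excluded for
`0 < m < n` (`CyclicallyGood`).

*Even lengths.* The Thue–Morse morphism preserves the absence of such coincidences: an odd shift is
impossible in a word cut into blocks `01` and `10` (`IsDoubling.even_of_matches`), and an even shift
descends to the preimage (`IsDoubling.matches_half`). The position `i` for length `n` thus gives the
position `2 * i` for length `2 * n` (`CyclicallyGood.double`). The same descent shows that `t` is
overlap-free (`length_le_of_matches`).

*Odd lengths.* For odd `n` only the periods `m ≤ 11` matter, whatever the factor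
(`eq_small_of_cyclic_matches`). The coincidences form runs, in which `z (p)` and `z (p + m)` either lie in
the same copy of the factor, which is a coincidence of `t` with itself under the shift `m`, or in
neighbouring copies, which is one under the shift `n - m`. One of the two shifts is odd and then its runs
have length at most `3` (`length_le_three_of_matches_of_odd`). By overlap-freeness each run is no longer
than its shift, and a run between neighbouring copies has at most `m` positions anyway; more than `3m/2`
consecutive coincidences then force `m ≤ 11`, and for `m = 11` they force the position
(`mod_add_eq_of_matches_eleven`). So only the 50 letters around the place where the end of the factor
meets its beginning matter.
Writing `i = 64 q + s` and `i + n = 64 (q + d) + s'`, these letters are determined, up to complementation,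
by `s`, `s'` and the sum `t q + t (q + d)`, which takes both values as `q` varies
(`exists_thueMorse_add_eq`). A finite search supplies `s`, `s'` and the sum for each residue of `n`
modulo 64 (`exists_seam`), and a position for each odd `n < 59` (`exists_position_of_lt`).
-/

/-! ### Coincidences of a word with a shift of itself -/

/-- The word `y` agrees with its shift by `m` at the `L` consecutive positions from `a` on. -/
def Matches (y : InfWord (Fin 2)) (a m L : ℕ) : Prop :=
  ∀ k < L, y (a + k) = y (a + k + m)

theorem Matches.sub {y : InfWord (Fin 2)} {a m L b M : ℕ} (h : Matches y a m L)
    (hab : a ≤ b) (hM : b + M ≤ a + L) : Matches y b m M := by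
  intro k hk
  have := h (b - a + k) (by omega)
  rwa [show a + (b - a + k) = b + k by omega] at this

/-- `y` is the image of `z` under the Thue–Morse morphism; the letters `0`, `1` are added modulo
`2`. -/
def IsDoubling (y z : InfWord (Fin 2)) : Prop :=
  ∀ p, y (2 * p) = z p ∧ y (2 * p + 1) = z p + 1

/-- In an image under the morphism, the letters `y p`, `y (p + 1)` are distinct for even `p`. For an
odd shift each pair of neighbouring positions, or its shift, is of this form, so that the matching
stretch alternates; being longer than the odd shift, it cannot match. -/
theorem IsDoubling.even_of_matches {y z : InfWord (Fin 2)} (hy : IsDoubling y z) {a m L : ℕ}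
    (h : Matches y a m L) (hL : m < L) : Even m := by
  by_contra hodd
  rw [Nat.not_even_iff_odd] at hodd
  obtain ⟨e, rfl⟩ := hodd
  have step : ∀ k, k + 1 < L → y (a + (k + 1)) = y (a + k) + 1 := by
    intro k hk
    rcases Nat.even_or_odd' (a + k) with ⟨c, hc | hc⟩
    · rw [← add_assoc, hc, (hy c).1, (hy c).2]
    · rw [h (k + 1) hk, h k (by omega),
        show a + k + (2 * e + 1) = 2 * (c + e + 1) by omega,
        show a + (k + 1) + (2 * e + 1) = 2 * (c + e + 1) + 1 by omega,
        (hy _).1, (hy _).2]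
  have alt : ∀ k, 2 * k + 1 < L → y (a + (2 * k + 1)) = y a + 1 := by
    intro k
    induction k with
    | zero => intro hk; simpa using step 0 (by omega)
    | succ k ih =>
      intro hk
      rw [show 2 * (k + 1) + 1 = 2 * k + 1 + 1 + 1 by ring, step _ (by omega), step _ (by omega),
        ih (by omega), add_assoc, show (1 + 1 : Fin 2) = 0 from rfl, add_zero]
  have h1 := alt e hL
  have h2 := h 0 (by omega)
  rw [add_zero] at h2
  rw [← h2] at h1
  generalize y a = v at h1
  revert v
  decide

theorem IsDoubling.matches_half {y z : InfWord (Fin 2)} (hy : IsDoubling y z) {a m L : ℕ}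
    (h : Matches y a (2 * m) L) : Matches z (a / 2) m ((L + 1) / 2) := by
  intro k hk
  have h1 := h (2 * k) (by omega)
  rcases Nat.even_or_odd' a with ⟨c, rfl | rfl⟩
  · rw [show 2 * c + 2 * k + 2 * m = 2 * (c + k + m) by ring, ← mul_add, (hy _).1, (hy _).1] at h1
    rwa [show 2 * c / 2 = c by omega]
  · rw [show 2 * c + 1 + 2 * k + 2 * m = 2 * (c + k + m) + 1 by ring,
      show 2 * c + 1 + 2 * k = 2 * (c + k) + 1 by ring, (hy _).2, (hy _).2] at h1
    rw [show (2 * c + 1) / 2 = c by omega]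
    exact add_right_cancel h1

/-! ### The Thue–Morse word -/

theorem getElem?_thueMorseMorphism (w : List (Fin 2)) (i : ℕ) :
    (thueMorseMorphism w)[2 * i]? = w[i]? ∧
      (thueMorseMorphism w)[2 * i + 1]? = w[i]?.map (· + 1) := by
  induction w generalizing i with
  | nil => simp [thueMorseMorphism]
  | cons a w ih =>
    have ha : thueMorseMorphism (a :: w) = a :: (a + 1) :: thueMorseMorphism w := by
      fin_cases a <;> rfl
    rw [ha]
    cases i with
    | zero => simp
    | succ i => simpa [mul_add, add_right_comm] using ih i

theorem thueMorseMorphism_prefix {v w : List (Fin 2)} (h : v <+: w) :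
    thueMorseMorphism v <+: thueMorseMorphism w := by
  obtain ⟨u, rfl⟩ := h
  exact ⟨thueMorseMorphism u, by simp [thueMorseMorphism]⟩

theorem iterate_thueMorseMorphism_prefix {a b : ℕ} (hab : a ≤ b) :
    thueMorseMorphism^[a] [0] <+: thueMorseMorphism^[b] [0] := by
  have step : ∀ b, thueMorseMorphism^[b] [0] <+: thueMorseMorphism^[b + 1] [0] := by
    intro b
    induction b with
    | zero => exact ⟨[1], rfl⟩
    | succ b ih =>
      rw [Function.iterate_succ_apply', Function.iterate_succ_apply' _ (b + 1)]
      exact thueMorseMorphism_prefix ih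
  induction hab with
  | refl => exact List.prefix_rfl
  | step _ ih => exact ih.trans (step _)

theorem thueMorse_eq_getElem? {n a : ℕ} (h : n ≤ a) :
    (thueMorseMorphism^[a] [0])[n]? = some (thueMorse n) := by
  have hn : n < (thueMorseMorphism^[n] [0]).length := by
    rw [length_iterate_thueMorseMorphism]; exact Nat.lt_two_pow_self
  obtain ⟨u, hu⟩ := iterate_thueMorseMorphism_prefix h
  rw [← hu, List.getElem?_append_left hn, List.getElem?_eq_getElem hn]
  rfl

theorem isDoubling_thueMorse : IsDoubling thueMorse thueMorse := by
  intro n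
  have h := getElem?_thueMorseMorphism (thueMorseMorphism^[2 * n] [0]) n
  rw [← Function.iterate_succ_apply' thueMorseMorphism, thueMorse_eq_getElem? (by omega),
    thueMorse_eq_getElem? (by omega), thueMorse_eq_getElem? (by omega)] at h
  simpa using h

theorem thueMorse_block (r q x : ℕ) (hx : x < 2 ^ r) :
    thueMorse (2 ^ r * q + x) = thueMorse q + thueMorse x := by
  induction r generalizing x with
  | zero =>
    obtain rfl : x = 0 := by simpa using hx
    have : thueMorse 0 = 0 := rfl
    simp [this]
  | succ r ih =>
    rw [pow_succ] at hx ⊢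
    rcases Nat.even_or_odd' x with ⟨c, rfl | rfl⟩
    · rw [show 2 ^ r * 2 * q + 2 * c = 2 * (2 ^ r * q + c) by ring, (isDoubling_thueMorse _).1,
        (isDoubling_thueMorse _).1, ih c (by omega)]
    · rw [show 2 ^ r * 2 * q + (2 * c + 1) = 2 * (2 ^ r * q + c) + 1 by ring,
        (isDoubling_thueMorse _).2, (isDoubling_thueMorse _).2, ih c (by omega), add_assoc]

/-- The parity of the sum of the lowest `f` binary digits of `n`. -/
def digitParity : ℕ → ℕ → Bool
  | 0, _ => false
  | f + 1, n => (n % 2 == 1) != digitParity f (n / 2)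

theorem thueMorse_eq_digitParity {f n : ℕ} (h : n < 2 ^ f) :
    thueMorse n = if digitParity f n then 1 else 0 := by
  induction f generalizing n with
  | zero =>
    obtain rfl : n = 0 := by simpa using h
    rfl
  | succ f ih =>
    rw [pow_succ] at h
    have hs := ih (n := n / 2) (by omega)
    rcases Nat.even_or_odd' n with ⟨c, rfl | rfl⟩
    · rw [show 2 * c / 2 = c by omega] at hs
      rw [(isDoubling_thueMorse c).1, hs]
      simp [digitParity]
    · rw [show (2 * c + 1) / 2 = c by omega] at hs
      rw [(isDoubling_thueMorse c).2, hs]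
      have : (2 * c + 1) / 2 = c := by omega
      simp only [digitParity, this, Nat.mul_add_mod, Nat.one_mod]
      cases digitParity f c <;> rfl

/-- The first 128 letters of the Thue–Morse word, as the binary digits of one number, from the lowest
on: in this form the kernel evaluates a letter by two operations on literals. -/
def thueMorseBit (x : ℕ) : Bool :=
  Nat.beq (Nat.mod (Nat.shiftRight 0x96696996699696696996966996696996 x) 2) 1

theorem thueMorse_eq_thueMorseBit {x : ℕ} (h : x < 128) :
    thueMorse x = if thueMorseBit x then 1 else 0 := by
  have hb : ∀ x < 128, thueMorseBit x = digitParity 7 x := by decide +kernel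
  rw [hb x h]
  exact thueMorse_eq_digitParity (by omega)

/-- The Thue–Morse word is overlap-free. -/
theorem length_le_of_matches {a d L : ℕ} (hd : 0 < d) (h : Matches thueMorse a d L) : L ≤ d := by
  induction d using Nat.strong_induction_on generalizing a L with
  | _ d ih =>
    by_contra hL
    obtain ⟨e, he⟩ := isDoubling_thueMorse.even_of_matches h (by omega)
    obtain rfl : d = 2 * e := by omega
    have := ih e (by omega) (by omega) (isDoubling_thueMorse.matches_half h)
    omega

theorem length_le_three_of_matches_of_odd {a d L : ℕ} (hd : Odd d)
    (h : Matches thueMorse a d L) : L ≤ 3 := by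
  by_contra hL
  have T := isDoubling_thueMorse
  obtain ⟨e, rfl⟩ := hd
  -- Four alternating letters at an odd position stem from three equal letters in the preimage.
  have cube : ∀ c, thueMorse c = thueMorse (c + 1) → thueMorse (c + 1) = thueMorse (c + 2) →
      False := by
    intro c h1 h2
    have : Matches thueMorse c 1 2 := by
      intro k hk
      interval_cases k
      · exact h1
      · exact h2
    have := length_le_of_matches one_pos this
    omega
  have h0 := h 0 (by omega)
  have h1 := h 1 (by omega)
  have h2 := h 2 (by omega)
  have h3 := h 3 (by omega)
  rcases Nat.even_or_odd' a with ⟨b, rfl | rfl⟩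
  · rw [show 2 * b + 0 + (2 * e + 1) = 2 * (b + e) + 1 by ring, add_zero, (T _).1, (T _).2] at h0
    rw [show 2 * b + 1 + (2 * e + 1) = 2 * (b + e + 1) by ring, (T _).1, (T _).2] at h1
    rw [show 2 * b + 2 + (2 * e + 1) = 2 * (b + e + 1) + 1 by ring,
      show 2 * b + 2 = 2 * (b + 1) by ring, (T _).1, (T _).2] at h2
    rw [show 2 * b + 3 + (2 * e + 1) = 2 * (b + e + 2) by ring,
      show 2 * b + 3 = 2 * (b + 1) + 1 by ring, (T _).1, (T _).2] at h3
    apply cube (b + e) <;>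
    · generalize thueMorse b = x1, thueMorse (b + 1) = x2, thueMorse (b + e) = x3,
        thueMorse (b + e + 1) = x4, thueMorse (b + e + 2) = x5 at *
      clear cube h T hL
      revert x1 x2 x3 x4 x5
      decide
  · rw [show 2 * b + 1 + 0 + (2 * e + 1) = 2 * (b + e + 1) by ring, add_zero, (T _).1,
      (T _).2] at h0
    rw [show 2 * b + 1 + 1 + (2 * e + 1) = 2 * (b + e + 1) + 1 by ring,
      show 2 * b + 1 + 1 = 2 * (b + 1) by ring, (T _).1, (T _).2] at h1
    rw [show 2 * b + 1 + 2 + (2 * e + 1) = 2 * (b + e + 2) by ring,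
      show 2 * b + 1 + 2 = 2 * (b + 1) + 1 by ring, (T _).1, (T _).2] at h2
    rw [show 2 * b + 1 + 3 + (2 * e + 1) = 2 * (b + e + 2) + 1 by ring,
      show 2 * b + 1 + 3 = 2 * (b + 2) by ring, (T _).1, (T _).2] at h3
    apply cube b <;>
    · generalize thueMorse b = x1, thueMorse (b + 1) = x2, thueMorse (b + 2) = x3,
        thueMorse (b + e + 1) = x4, thueMorse (b + e + 2) = x5 at *
      clear cube h T hL
      revert x1 x2 x3 x4 x5
      decide

theorem exists_thueMorse_add_eq {d : ℕ} (hd : 0 < d) (b : Fin 2) :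
    ∃ q, thueMorse q + thueMorse (q + d) = b := by
  by_contra! h
  -- If the sum were constantly `b + 1`, the word `t` would have period `2 * d`.
  have hs : ∀ q, thueMorse q = thueMorse (q + 2 * d) := by
    intro q
    have h1 := h q
    have h2 := h (q + d)
    rw [add_assoc, ← two_mul] at h2
    generalize thueMorse q = x, thueMorse (q + d) = y, thueMorse (q + 2 * d) = v at *
    clear h
    revert b x y v
    decide
  have := length_le_of_matches (a := 0) (L := 2 * d + 1) (by omega) (fun k _ => hs (0 + k))
  omega

/-! ### Cyclic repetitions of factors -/

/-- The infinite repetition of the factor of length `n` at position `i` of the Thue–Morse word. -/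
def cyclicThueMorse (i n : ℕ) : InfWord (Fin 2) :=
  fun p => thueMorse (i + p % n)

/-- The infinite repetition of the factor of length `n` at position `i` contains no `5/2⁺`-power of a
period less than `n`. A word `u` of period `m` has `|u| > 5m/2` if and only if it has more than
`3m/2` positions with a successor at distance `m`. -/
def CyclicallyGood (i n : ℕ) : Prop :=
  ∀ m, 0 < m → m < n → ∀ j, ¬ Matches (cyclicThueMorse i n) j m (3 * m / 2 + 1)

theorem isDoubling_cyclicThueMorse (i n : ℕ) :
    IsDoubling (cyclicThueMorse (2 * i) (2 * n)) (cyclicThueMorse i n) := by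
  intro p
  have h1 : (2 * p) % (2 * n) = 2 * (p % n) := Nat.mul_mod_mul_left 2 p n
  have h2 : (2 * p + 1) % (2 * n) = 2 * (p % n) + 1 := by
    rcases Nat.eq_zero_or_pos n with rfl | hn
    · simp
    · have := Nat.mod_lt p hn
      rw [Nat.add_mod, h1, Nat.mod_eq_of_lt (a := 1) (by omega), Nat.mod_eq_of_lt (by omega)]
  unfold cyclicThueMorse
  rw [h1, h2, ← mul_add, ← add_assoc, ← mul_add]
  exact isDoubling_thueMorse _

theorem CyclicallyGood.double {i n : ℕ} (h : CyclicallyGood i n) :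
    CyclicallyGood (2 * i) (2 * n) := by
  intro m hm hmn j hj
  have hd := isDoubling_cyclicThueMorse i n
  obtain ⟨e, he⟩ := hd.even_of_matches hj (by omega)
  obtain rfl : m = 2 * e := by omega
  exact h e (by omega) (by omega) _ ((hd.matches_half hj).sub le_rfl (by omega))

theorem cyclicThueMorse_add_mul (i n p c : ℕ) :
    cyclicThueMorse i n (n * c + p) = cyclicThueMorse i n p := by
  simp [cyclicThueMorse]

theorem cyclicThueMorse_of_lt {i n p : ℕ} (c : ℕ) (h1 : n * c ≤ p) (h2 : p < n * c + n) :
    cyclicThueMorse i n p = thueMorse (i + (p - n * c)) := by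
  obtain ⟨e, rfl⟩ := Nat.exists_eq_add_of_le h1
  rw [cyclicThueMorse_add_mul, cyclicThueMorse, Nat.mod_eq_of_lt (by omega), Nat.add_sub_cancel_left]

theorem Matches.mod {i n j m L : ℕ} (h : Matches (cyclicThueMorse i n) j m L) :
    Matches (cyclicThueMorse i n) (j % n) m L := by
  intro k hk
  have := h k hk
  have e := Nat.div_add_mod j n
  rw [← e, add_assoc, add_assoc, cyclicThueMorse_add_mul, cyclicThueMorse_add_mul] at this
  simpa [add_assoc] using this

/-- A run inside the `c`-th copy of the factor. -/
theorem matches_of_same_copy {i n j m L : ℕ} (h : Matches (cyclicThueMorse i n) j m L) (c : ℕ)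
    (h1 : n * c ≤ j) (h2 : j + L + m ≤ n * c + n) :
    Matches thueMorse (i + (j - n * c)) m L := by
  intro k hk
  have := h k hk
  rw [cyclicThueMorse_of_lt c (by omega) (by omega),
    cyclicThueMorse_of_lt c (by omega) (by omega)] at this
  convert this using 2 <;> omega

/-- A run from the `c`-th copy of the factor to the next. -/
theorem matches_of_next_copy {i n j m L : ℕ} (h : Matches (cyclicThueMorse i n) j m L) (c : ℕ)
    (h1 : n * c + n ≤ j + m) (h2 : j + L ≤ n * c + n) (hm : m < n) :
    Matches thueMorse (i + (j + m - (n * c + n))) (n - m) L := by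
  intro k hk
  have := h k hk
  rw [cyclicThueMorse_of_lt c (by omega) (by omega),
    cyclicThueMorse_of_lt (c + 1) (by rw [mul_add]; omega) (by rw [mul_add]; omega), mul_add] at this
  refine Eq.trans ?_ (this.symm.trans ?_) <;> congr 1 <;> omega

/-- In the repetition of a factor of odd length `n`, a `5/2⁺`-power of period less than `n` has
period at most `11`. -/
theorem eq_small_of_cyclic_matches {i n j m : ℕ} (hn : Odd n) (hm : 0 < m) (hmn : m < n)
    (h : Matches (cyclicThueMorse i n) j m (3 * m / 2 + 1)) : m ≤ 11 := by
  by_contra! hbig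
  replace h := h.mod
  have hj := Nat.mod_lt j (show 0 < n by omega)
  generalize j % n = p at h hj
  have same : ∀ c x L, p ≤ x → x + L ≤ p + (3 * m / 2 + 1) → n * c ≤ x →
      x + L + m ≤ n * c + n → Matches thueMorse (i + (x - n * c)) m L :=
    fun c x L a1 a2 a3 a4 => matches_of_same_copy (h.sub a1 a2) c a3 a4
  have next : ∀ c x L, p ≤ x → x + L ≤ p + (3 * m / 2 + 1) → n * c + n ≤ x + m →
      x + L ≤ n * c + n → Matches thueMorse (i + (x + m - (n * c + n))) (n - m) L :=
    fun c x L a1 a2 a3 a4 => matches_of_next_copy (h.sub a1 a2) c a3 a4 hmn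
  -- In each case below there is room for a run that is too long for its shift, in one of the first two
  -- copies of the factor or across their ends.
  rcases Nat.even_or_odd m with hme | hmo
  · have hodd : Odd (n - m) := Nat.Odd.sub_even hmn.le hn hme
    obtain ⟨e, he⟩ := hme
    have next' : ∀ c x, p ≤ x → x + 4 ≤ p + (3 * m / 2 + 1) → n * c + n ≤ x + m →
        x + 4 ≤ n * c + n → False := by
      intro c x a1 a2 a3 a4
      have := length_le_three_of_matches_of_odd hodd (next c x 4 a1 a2 a3 a4)
      omega
    have same' : ∀ c x, p ≤ x → x + (m + 1) ≤ p + (3 * m / 2 + 1) → n * c ≤ x →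
        x + (m + 1) + m ≤ n * c + n → False := by
      intro c x a1 a2 a3 a4
      have := length_le_of_matches hm (same c x (m + 1) a1 a2 a3 a4)
      omega
    rcases le_or_gt p (n - m) with hp | hp
    · by_cases hq : n - m + 4 ≤ p + (3 * m / 2 + 1)
      · exact next' 0 (n - m) (by omega) (by omega) (by omega) (by omega)
      · exact same' 0 p (by omega) (by omega) (by omega) (by omega)
    · by_cases hp4 : p + 4 ≤ n
      · exact next' 0 p (by omega) (by omega) (by omega) (by omega)
      · by_cases hq : 2 * n - m + 4 ≤ p + (3 * m / 2 + 1)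
        · exact next' 1 (2 * n - m) (by omega) (by omega) (by omega) (by omega)
        · exact same' 1 n (by omega) (by omega) (by omega) (by omega)
  · have same' : ∀ c x, p ≤ x → x + 4 ≤ p + (3 * m / 2 + 1) → n * c ≤ x →
        x + 4 + m ≤ n * c + n → False := by
      intro c x a1 a2 a3 a4
      have := length_le_three_of_matches_of_odd hmo (same c x 4 a1 a2 a3 a4)
      omega
    obtain ⟨e, he⟩ := hmo
    by_cases hs : n - m ≤ 3
    · have next' : ∀ c x, p ≤ x → x + 4 ≤ p + (3 * m / 2 + 1) → n * c + n ≤ x + m →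
          x + 4 ≤ n * c + n → False := by
        intro c x a1 a2 a3 a4
        have := length_le_of_matches (by omega) (next c x 4 a1 a2 a3 a4)
        omega
      by_cases hp : p ≤ n - m
      · exact next' 0 (n - m) (by omega) (by omega) (by omega) (by omega)
      · by_cases hp4 : p + 4 ≤ n
        · exact next' 0 p (by omega) (by omega) (by omega) (by omega)
        · exact next' 1 (2 * n - m) (by omega) (by omega) (by omega) (by omega)
    · by_cases hp : p + 4 + m ≤ n
      · exact same' 0 p (by omega) (by omega) (by omega) (by omega)
      · exact same' 1 n (by omega) (by omega) (by omega) (by omega)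

/-! ### Positions for every length -/

/-- In the situation of `eq_small_of_cyclic_matches`, the period `11` leaves a single position
relative to the seam: the `17` coincidences split into runs of lengths `3`, `11`, `3`. -/
theorem mod_add_eq_of_matches_eleven {i n j : ℕ} (hn : 15 ≤ n)
    (h : Matches (cyclicThueMorse i n) j 11 17) : j % n + 14 = n := by
  by_contra hne
  replace h := h.mod
  have hj := Nat.mod_lt j (show 0 < n by omega)
  generalize j % n = p at h hj hne
  have same : ∀ c x, p ≤ x → x + 4 ≤ p + 17 → n * c ≤ x → x + 4 + 11 ≤ n * c + n → False := by
    intro c x a1 a2 a3 a4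
    have := length_le_three_of_matches_of_odd (by decide)
      (matches_of_same_copy (h.sub a1 a2) c a3 a4)
    omega
  by_cases hp : p + 4 + 11 ≤ n
  · exact same 0 p (by omega) (by omega) (by omega) (by omega)
  · exact same 1 n (by omega) (by omega) (by omega) (by omega)

/-- The finite word `g 0, …, g (L - 1)` has no `5/2⁺`-power of a period `m` with `0 < m ≤ M` as a
factor. Such a power may be cut to the length `5 * m / 2 + 1`. -/
def noShortPowers (g : ℕ → Bool) (L M : ℕ) : Bool :=
  (List.range M).all fun m => (List.range (L - 5 * (m + 1) / 2)).all fun x =>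
    (List.range (3 * (m + 1) / 2 + 1)).any fun k => g (x + k) != g (x + k + (m + 1))

theorem exists_ne_of_noShortPowers {g : ℕ → Bool} {L M : ℕ} (h : noShortPowers g L M = true)
    {m x : ℕ} (hm : 0 < m) (hm' : m ≤ M) (hx : x + 5 * m / 2 < L) :
    ∃ k < 3 * m / 2 + 1, g (x + k) ≠ g (x + k + m) := by
  obtain ⟨m, rfl⟩ := Nat.exists_eq_succ_of_ne_zero hm.ne'
  simp only [noShortPowers, List.all_eq_true, List.any_eq_true, List.mem_range, bne_iff_ne] at h
  exact h m (by omega) x (by simp only [Nat.succ_eq_add_one] at hx; omega)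

/-- The 50 letters around the seam: 25 letters before position `s'` of a block of length 64 of the
Thue–Morse word, and 25 letters from position `s` of such a block on; the second block is
complemented if `b` holds. -/
def seam (s s' : ℕ) (b : Bool) (x : ℕ) : Bool :=
  if x < 25 then thueMorseBit (s' + x - 25) else b != thueMorseBit (s + x - 25)

/-- For `e < 32`, the numbers `2 * e - 5` run through the odd residues modulo 64. -/
theorem exists_seam {e : ℕ} (he : e < 32) :
    ∃ s < 39, 25 ≤ s + 2 * e - 5 ∧ s + 2 * e - 5 ≤ 64 ∧
      ∃ b, noShortPowers (seam s (s + 2 * e - 5) b) 50 11 = true := by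
  -- The list holds, for each `e`, a suitable `s`; the second block is complemented except for four `e`.
  have h : ∀ e < 32, ∃ s ∈ [30, 32, 27, 26, 22, 20, 18, 19, 22, 14, 10, 12, 6, 8, 3, 2, 6, 0, 2, 3,
      6, 0, 3, 2, 6, 0, 6, 2, 6, 3, 2, 3][e]?, s < 39 ∧ 25 ≤ s + 2 * e - 5 ∧ s + 2 * e - 5 ≤ 64 ∧
      noShortPowers (seam s (s + 2 * e - 5) (decide (e ∉ [4, 16, 26, 28]))) 50 11 = true := by
    decide +kernel
  obtain ⟨s, -, h1, h2, h3, h4⟩ := h e he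
  exact ⟨s, h1, h2, h3, _, h4⟩

/-- The cutoff `2 * e + 28` admits every start in one turn: a power of period `m ≤ 11` may be cut to
length at most `28`. -/
theorem exists_position_of_lt {e : ℕ} (he : e < 29) :
    ∃ i < 39, noShortPowers (fun p => thueMorseBit (i + p % (2 * e + 1))) (2 * e + 28)
      (min 11 (2 * e)) = true := by
  -- The list holds, for each odd length `2 * e + 1`, a suitable position.
  have h : ∀ e < 29, ∃ i ∈ [0, 0, 0, 3, 2, 6, 0, 18, 2, 22, 3, 2, 3, 6, 0, 3, 2, 30, 0, 2, 3, 38, 0,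
      6, 3, 6, 2, 3, 2][e]?, i < 39 ∧
      noShortPowers (fun p => thueMorseBit (i + p % (2 * e + 1))) (2 * e + 28)
        (min 11 (2 * e)) = true := by
    decide +kernel
  obtain ⟨i, -, h1, h2⟩ := h e he
  exact ⟨i, h1, h2⟩

theorem exists_cyclicallyGood_of_odd_of_lt {n : ℕ} (hn : Odd n) (hlt : n < 59) :
    ∃ i, CyclicallyGood i n := by
  obtain ⟨e, rfl⟩ := hn
  obtain ⟨i, hi, h⟩ := exists_position_of_lt (e := e) (by omega)
  refine ⟨i, fun m hm hmn j hj => ?_⟩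
  have hsmall := eq_small_of_cyclic_matches ⟨e, rfl⟩ hm hmn hj
  have hmod := Nat.mod_lt j (show 0 < 2 * e + 1 by omega)
  obtain ⟨k, hk, hne⟩ := exists_ne_of_noShortPowers h (x := j % (2 * e + 1)) hm (by omega) (by omega)
  refine hne ?_
  have hb : ∀ p, cyclicThueMorse i (2 * e + 1) p =
      if thueMorseBit (i + p % (2 * e + 1)) then 1 else 0 := fun p => by
    have := Nat.mod_lt p (show 0 < 2 * e + 1 by omega)
    exact thueMorse_eq_thueMorseBit (by omega)
  have heq := hj.mod k hk
  rw [hb, hb] at heq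
  revert heq
  generalize thueMorseBit _ = u, thueMorseBit _ = v
  revert u v
  decide

theorem exists_cyclicallyGood_of_odd_of_le {n : ℕ} (hn : Odd n) (hle : 59 ≤ n) :
    ∃ i, CyclicallyGood i n := by
  -- The residues of `n` are represented by `-5, -3, …, 57`.
  obtain ⟨d, e, hd, he, hde⟩ : ∃ d e, 0 < d ∧ e < 32 ∧ n + 5 = 64 * d + 2 * e := by
    obtain ⟨f, rfl⟩ := hn
    exact ⟨(f + 3) / 32, (f + 3) % 32, by omega, by omega, by omega⟩
  obtain ⟨s, hs, hs1, hs2, b, hb⟩ := exists_seam he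
  obtain ⟨q, hq⟩ := exists_thueMorse_add_eq hd (if b then 1 else 0)
  refine ⟨64 * q + s, fun m hm hmn j hj => ?_⟩
  have hsmall := eq_small_of_cyclic_matches hn hm hmn hj
  have h11 : m = 11 → j % n + 14 = n := by
    rintro rfl
    exact mod_add_eq_of_matches_eleven (by omega) hj
  replace hj := hj.mod
  have hmod := Nat.mod_lt j (show 0 < n by omega)
  generalize j % n = p at hj hmod h11
  by_cases hcross : p + 5 * m / 2 < n
  · have := length_le_of_matches hm (matches_of_same_copy hj 0 (by omega) (by omega))
    omega
  · -- The power crosses exactly one seam; it is read in the 50 letters from `n - 25` on.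
    have hval : ∀ x < 50, cyclicThueMorse (64 * q + s) n (n - 25 + x) =
        thueMorse (q + d) + if seam s (s + 2 * e - 5) b x then 1 else 0 := by
      intro x hx
      rcases lt_or_ge x 25 with hx' | hx'
      · rw [cyclicThueMorse_of_lt 0 (by omega) (by omega),
          show 64 * q + s + (n - 25 + x - n * 0) =
            2 ^ 6 * (q + d) + (s + 2 * e - 5 + x - 25) by omega,
          thueMorse_block 6 _ _ (by omega),
          thueMorse_eq_thueMorseBit (x := s + 2 * e - 5 + x - 25) (by omega), seam,
          if_pos hx']
      · rw [cyclicThueMorse_of_lt 1 (by omega) (by omega),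
          show 64 * q + s + (n - 25 + x - n * 1) = 2 ^ 6 * q + (s + x - 25) by omega,
          thueMorse_block 6 _ _ (by omega),
          thueMorse_eq_thueMorseBit (x := s + x - 25) (by omega), seam,
          if_neg (show ¬ x < 25 by omega)]
        generalize thueMorse q = u, thueMorse (q + d) = v, thueMorseBit _ = w at hq ⊢
        clear hb
        revert u v w b
        decide
    obtain ⟨k, hk, hne⟩ := exists_ne_of_noShortPowers hb (x := p - (n - 25)) hm hsmall (by omega)
    refine hne ?_
    have heq := hj k hk
    rw [show p + k = n - 25 + (p - (n - 25) + k) by omega, add_assoc (n - 25), hval _ (by omega),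
      hval _ (by omega)] at heq
    replace heq := add_left_cancel heq
    revert heq
    generalize seam _ _ _ _ = u, seam _ _ _ _ = v
    revert u v
    decide

theorem exists_cyclicallyGood (n : ℕ) : ∃ i, CyclicallyGood i n := by
  induction n using Nat.strong_induction_on with
  | _ n ih =>
    rcases Nat.even_or_odd' n with ⟨c, rfl | rfl⟩
    · rcases Nat.eq_zero_or_pos c with rfl | hc
      · exact ⟨0, fun m hm hmn => by omega⟩
      · obtain ⟨i, hi⟩ := ih c (by omega)
        exact ⟨2 * i, hi.double⟩
    · rcases lt_or_ge (2 * c + 1) 59 with h | h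
      · exact exists_cyclicallyGood_of_odd_of_lt ⟨c, rfl⟩ h
      · exact exists_cyclicallyGood_of_odd_of_le ⟨c, rfl⟩ h

/-! ### Powers as finite words -/

theorem drop_prefix_of_power {α : Type*} {x y : List α} (hy : y <+: x) (k : ℕ) :
    ((List.replicate k x).flatten ++ y).drop x.length <+: (List.replicate k x).flatten ++ y := by
  cases k with
  | zero => simpa using (List.drop_eq_nil_of_le hy.length_le).symm ▸ List.nil_prefix
  | succ k =>
    obtain ⟨v, rfl⟩ := hy
    have h : (List.replicate (k + 1) (y ++ v)).flatten =
        (List.replicate k (y ++ v)).flatten ++ (y ++ v) := by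
      rw [List.replicate_succ']; simp
    refine List.IsPrefix.trans (l₂ := (List.replicate (k + 1) (y ++ v)).flatten) ?_
      (List.prefix_append _ _)
    conv_lhs => rw [List.replicate_succ, List.flatten_cons, List.append_assoc, List.drop_left]
    rw [h]
    exact ⟨v, by simp⟩

/-- A `5/2⁺`-power of period `m` is longer than `5 * m / 2` and agrees with its shift by `m`. -/
theorem IsPlusPowerWithPeriod.periodic {α : Type*} {m : ℕ} {u : List α}
    (h : IsPlusPowerWithPeriod (5 / 2) m u) :
    0 < m ∧ 5 * m < 2 * u.length ∧ ∀ k, k + m < u.length → u[k]? = u[k + m]? := by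
  obtain ⟨R, hR, -, x, y, k, hx, rfl, hy, rfl, rfl⟩ := h
  have hpos : 0 < x.length := List.length_pos_iff.mpr hx
  refine ⟨hpos, ?_, fun l hl => ?_⟩
  · have hq : (0 : ℚ) < x.length := by exact_mod_cast hpos
    have h2 : (5 : ℚ) * x.length < 2 * (k * x.length + y.length) := by
      have := mul_lt_mul_of_pos_right hR hq
      rw [add_mul, div_mul_cancel₀ _ hq.ne'] at this
      linarith
    have h3 : 5 * x.length < 2 * (k * x.length + y.length) := by exact_mod_cast h2
    simpa using h3
  · obtain ⟨v, hv⟩ := drop_prefix_of_power hy k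
    generalize (List.replicate k x).flatten ++ y = u at hl hv
    conv_lhs => rw [← hv]
    rw [List.getElem?_append_left (by rw [List.length_drop]; omega), List.getElem?_drop, add_comm]

theorem avoidsPlusPowersCyclically_of_cyclicallyGood {i n : ℕ} (h : CyclicallyGood i n) :
    AvoidsPlusPowersCyclically (5 / 2) ((List.range n).map fun j => thueMorse (i + j)) := by
  intro hw u m hu ⟨j, hj⟩
  obtain ⟨hm, hlen, hper⟩ := hu.periodic
  by_contra hmn
  simp only [List.length_map, List.length_range, not_le] at hmn
  refine h m hm hmn j fun k hk => ?_
  have hval : ∀ l, l < u.length → u[l]? = some (cyclicThueMorse i n (j + l)) := by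
    intro l hl
    rw [hj]
    simp [hl, omegaPower, cyclicThueMorse]
  have := hper k (by omega)
  rw [hval k (by omega), hval (k + m) (by omega)] at this
  simpa [add_assoc] using this

theorem mainTheorem4 :
    (∀ n : ℕ, ∃ w : List (Fin 2), w.length = n ∧ thueMorse.HasFactor w ∧
      AvoidsPlusPowersCyclically (5 / 2) w) ∧
    (∀ n : ℕ, ∃ w : List (Fin 2), w.length = n ∧ AvoidsPlusPowersCyclically (5 / 2) w) := by
  have key : ∀ n : ℕ, ∃ w : List (Fin 2), w.length = n ∧ thueMorse.HasFactor w ∧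
      AvoidsPlusPowersCyclically (5 / 2) w := by
    intro n
    obtain ⟨i, hi⟩ := exists_cyclicallyGood n
    exact ⟨(List.range n).map fun j => thueMorse (i + j), by simp, ⟨i, by simp⟩,
      avoidsPlusPowersCyclically_of_cyclicallyGood hi⟩
  refine ⟨key, fun n => ?_⟩
  obtain ⟨w, h1, -, h3⟩ := key n
  exact ⟨w, h1, h3⟩
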